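/- For $n\ge 0$ let $\mathrm{Haar}(n)$ be the Haar probability measure on the group $U(n)$ of $n\times n$ complex unitary matrices. A function $F:\mathbb{C}^N\to\mathbb{C}$ is called a degree-$d$ semi-polynomial if $F(z_1,\dots,z_N)$ is a polynomial of total degree at most $d$ with complex coefficients in $z_1,\dots,z_N,\overline{z_1},\dots,\overline{z_N}$. There are constants $C(n,m,d)>0$ and $C'(n,m,d)>0$, depending only on $n,m,d$, such that for all integers $1\le m\le n$ and $d\ge 1$ $$C(n,m,d)=\frac{1}{4nmd}\qquad\text{and}\qquad C'(n,m,d)\le K\,n^2md$$ with an absolute constant $K$, and such that the following two statements hold. (1) Let $0\le m\le n$ and $d\ge 0$, and let $F:\mathbb{C}^{nm}\to\mathbb{C}$ be a degree-$d$ semi-polynomial. Evaluate $F$ at the entries of the first $m$ columns of $U\in U(n)$, and suppose that $F(U_{1,1},\dots,U_{n,m})$ is a non-negative real number for every $U\in U(n)$ and is not identically zero on $U(n)$. Then for $U\sim\mathrm{Haar}(n)$ and every $\varepsilon>0$, $$\Pr\bigl[F(U_{1,1},\dots,U_{n,m})\le \varepsilon\,\mathbb{E}[F]\bigr]\le C'(n,m,d)\,\varepsilon^{C(n,m,d)}.$$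 (2) Let $n\ge 0$ and $d\ge 0$, and let $\tilde F:\mathbb{C}^{2n^2}\to\mathbb{C}$ be a polynomial of total degree at most $d$, evaluated at the entries of $U$ and of its conjugate transpose $U^\dagger$, such that $\tilde F(U,U^\dagger)$ is not identically zero on $U(n)$. Then for $U\sim\mathrm{Haar}(n)$ and every $\varepsilon>0$, $$\Pr\bigl[|\tilde F(U,U^\dagger)|^2\le \varepsilon\,\mathbb{E}\bigl[|\tilde F(U,U^\dagger)|^2\bigr]\bigr]\le C'(n,n,2d)\,\varepsilon^{C(n,n,2d)}.$$ -/

import Mathlib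

open MeasureTheory

/-- The group `U(n)` of `n × n` complex unitary matrices, with the topology of the entries. -/
abbrev UGroup (n : ℕ) : Type := Matrix.unitaryGroup (Fin n) ℂ

/-- The Borel σ-algebra on `U(n)`. -/
noncomputable instance UGroup.instMeasurableSpace (n : ℕ) : MeasurableSpace (UGroup n) := borel _

instance UGroup.instBorelSpace (n : ℕ) : BorelSpace (UGroup n) := ⟨rfl⟩

instance UGroup.instCompactSpace (n : ℕ) : CompactSpace (UGroup n) := by
  have hK : IsCompact (Set.univ.pi fun _ : Fin n => Set.univ.pi fun _ : Fin n =>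
      Metric.closedBall (0 : ℂ) 1) :=
    isCompact_univ_pi fun _ => isCompact_univ_pi fun _ => isCompact_closedBall _ _
  have hc : IsClosed {A : Matrix (Fin n) (Fin n) ℂ | star A * A = 1 ∧ A * star A = 1} :=
    (isClosed_eq (by fun_prop) continuous_const).inter
      (isClosed_eq (by fun_prop) continuous_const)
  refine isCompact_iff_compactSpace.mp (hK.of_isClosed_subset hc ?_)
  intro A hA i _ j _
  have hA' : A ∈ Matrix.unitaryGroup (Fin n) ℂ := hA
  simpa using entry_norm_bound_of_unitary hA' i j

/-- The Haar probability measure on `U(n)`: the Haar measure with total mass one. -/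
noncomputable def haarU (n : ℕ) : Measure (UGroup n) := Measure.haarMeasure ⊤

instance haarU.instIsHaarMeasure (n : ℕ) : (haarU n).IsHaarMeasure := by
  unfold haarU; infer_instance

instance haarU.instIsProbabilityMeasure (n : ℕ) : IsProbabilityMeasure (haarU n) :=
  ⟨by simpa [haarU] using Measure.haarMeasure_self (G := UGroup n) (K₀ := ⊤)⟩

/-- A function of complex variables `z_s` is a degree-`d` semi-polynomial if it is a polynomial
of total degree at most `d` in the `z_s` and their conjugates. -/
def IsSemiPolynomial {σ : Type*} (d : ℕ) (F : (σ → ℂ) → ℂ) : Prop :=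
  ∃ p : MvPolynomial (σ ⊕ σ) ℂ, p.totalDegree ≤ d ∧
    ∀ z : σ → ℂ, F z = MvPolynomial.eval (Sum.elim z fun s => (starRingEnd ℂ) (z s)) p

/-- The entries of the first `m` columns of `U`, as a point of `ℂ^(nm)`. -/
def firstCols {n m : ℕ} (h : m ≤ n) (U : UGroup n) : Fin n × Fin m → ℂ :=
  fun ij => (U : Matrix (Fin n) (Fin n) ℂ) ij.1 (Fin.castLE h ij.2)

/-- The value `p(U, U†)` of a polynomial `p` in `2n²` variables at the entries of `U` and of its
conjugate transpose. -/
noncomputable def evalUUdag {n : ℕ} (p : MvPolynomial ((Fin n × Fin n) ⊕ (Fin n × Fin n)) ℂ)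
    (U : UGroup n) : ℂ :=
  MvPolynomial.eval (Sum.elim
    (fun ij => (U : Matrix (Fin n) (Fin n) ℂ) ij.1 ij.2)
    (fun ij => (U : Matrix (Fin n) (Fin n) ℂ).conjTranspose ij.1 ij.2)) p

/-!
Small-ball estimates for polynomials on the unitary group, by negative moments.

Let `f` be a semi-polynomial of degree `d` in the first `m` columns of `U`, and `c = 1 / (4nmd)`.
By Markov's inequality it is enough to show `E ‖f‖ ^ (-c) ≤ e³ * ‖f U₀‖ ^ (-c)` for every `U₀`, and
to take for `U₀` a maximum point of `f` (`IsSemiPolynomial.lintegral_enorm_rpow_neg_le`).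

The Haar measure is right invariant, so `U` may be replaced by `U * T`, where
`T = projPhase P₁ w₁ * ⋯ * projPhase Pₖ wₖ` is a product of members of fixed one-parameter families
`w ↦ 1 + (w - 1) P`, with independent `wᵢ` uniform on the unit circle. No density or Jacobian
enters: it is only needed that, as the `wᵢ` vary, the first `m` columns of `U * T` take every
possible value, in particular that of `U₀`. Gaussian elimination does this with `k ≤ 3nm` families
(`exists_phaseProducts_firstCols_eq`).

Along each family `f` is a trigonometric polynomial of degree `d`, so that its modulus on the circle
is that of a polynomial with at most `2d` roots. Hölder's inequality over the roots reduces its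
negative moment of order `c` to those of linear factors of order at most `2dc = s = 1 / (2nm)`.
Since `|w - z|` is at least `1 + |z|`, its largest conceivable value, times twice the distance
(in turns) of `w` from the direction of `z`, such a moment costs a factor of at most
`∫₀¹ u ^ (-s) du = 1 / (1 - s)` against the value at any given point of the circle
(`Polynomial.lintegral_enorm_eval_rpow_neg_le`). Integrating out the `k` phases one at a time
(`exists_lintegral_eq_and_le_of_isTrigPolynomial`) gives the constant
`(1 - s) ^ (-k) ≤ exp (2 * s * k) ≤ e³`.

The statement on `p (U, U†)` is the case `m = n` for the semi-polynomial `‖p (U, U†)‖ ^ 2`.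
-/

/-! ### Negative moments of one-variable polynomials on the circle -/

theorem ENNReal.rpow_neg_le_rpow_neg {a b : ENNReal} {c : ℝ} (h : a ≤ b) (hc : 0 ≤ c) :
    b ^ (-c) ≤ a ^ (-c) := by
  rw [ENNReal.rpow_neg, ENNReal.rpow_neg]
  exact ENNReal.inv_le_inv.mpr (ENNReal.rpow_le_rpow h hc)

theorem one_add_mul_abs_le_norm_circleExp_sub {r x : ℝ} (hr : 0 ≤ r) (hx : |x| ≤ 1 / 2) :
    (1 + r) * (2 * |x|) ≤ ‖(Circle.exp (2 * Real.pi * x) : ℂ) - r‖ := by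
  have hpi := Real.pi_pos
  have hsin : 2 * |x| ≤ |Real.sin (Real.pi * x)| := by
    have h := Real.mul_abs_le_abs_sin (x := Real.pi * x)
      (by rw [abs_mul, abs_of_pos hpi]; nlinarith)
    rwa [abs_mul, abs_of_pos hpi, ← mul_assoc, div_mul_cancel₀ _ hpi.ne'] at h
  refine (mul_le_mul_of_nonneg_left hsin (by positivity)).trans ?_
  refine le_of_sq_le_sq ?_ (norm_nonneg _)
  have hn : ‖(Circle.exp (2 * Real.pi * x) : ℂ) - r‖ ^ 2 =
      (Real.cos (2 * Real.pi * x) - r) ^ 2 + Real.sin (2 * Real.pi * x) ^ 2 := by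
    rw [Complex.sq_norm, Complex.normSq_apply, Circle.coe_exp]
    simp only [Complex.sub_re, Complex.sub_im, Complex.exp_ofReal_mul_I_re,
      Complex.exp_ofReal_mul_I_im, Complex.ofReal_re, Complex.ofReal_im]
    ring
  have hc : Real.cos (2 * Real.pi * x) = 1 - 2 * Real.sin (Real.pi * x) ^ 2 := by
    rw [show 2 * Real.pi * x = 2 * (Real.pi * x) by ring, Real.cos_two_mul, Real.cos_sq']
    ring
  have h1 := Real.sin_sq_add_cos_sq (2 * Real.pi * x)
  have h2 := Real.sin_sq_le_one (Real.pi * x)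
  rw [hn, mul_pow, sq_abs]
  rw [hc] at h1 ⊢
  nlinarith [mul_nonneg (sq_nonneg (1 - r)) (sub_nonneg.2 h2)]

theorem setLIntegral_Ioc_two_mul_rpow_neg {s : ℝ} (hs : s < 1) :
    ∫⁻ x in Set.Ioc (0 : ℝ) (1 / 2), ENNReal.ofReal ((2 * x) ^ (-s)) =
      ENNReal.ofReal (1 / (1 - s) / 2) := by
  have hint : IntervalIntegrable (fun x : ℝ => (2 * x) ^ (-s)) volume 0 (1 / 2) := by
    have h := (intervalIntegral.intervalIntegrable_rpow' (a := 0) (b := 1) (r := -s)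
      (by linarith)).comp_mul_left (c := 2)
    simpa using h
  rw [← ofReal_integral_eq_lintegral_ofReal]
  · rw [← intervalIntegral.integral_of_le (by norm_num)]
    congr 1
    rw [intervalIntegral.integral_comp_mul_left (fun x : ℝ => x ^ (-s)) two_ne_zero,
      integral_rpow (Or.inl (by linarith))]
    have : -s + 1 ≠ 0 := by linarith
    norm_num [Real.zero_rpow this]
    rw [show -s + 1 = 1 - s by ring]
    ring
  · exact (intervalIntegrable_iff_integrableOn_Ioc_of_le (by norm_num)).1 hint
  · filter_upwards [ae_restrict_mem measurableSet_Ioc] with x hx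
    exact Real.rpow_nonneg (by linarith [hx.1]) _

theorem setLIntegral_Ioc_two_mul_abs_rpow_neg {s : ℝ} (hs : s < 1) :
    ∫⁻ x in Set.Ioc (-(1 / 2) : ℝ) (1 / 2), ENNReal.ofReal ((2 * |x|) ^ (-s)) =
      ENNReal.ofReal (1 / (1 - s)) := by
  have hpos : ∫⁻ x in Set.Ioc (0 : ℝ) (1 / 2), ENNReal.ofReal ((2 * |x|) ^ (-s)) =
      ENNReal.ofReal (1 / (1 - s) / 2) := by
    rw [← setLIntegral_Ioc_two_mul_rpow_neg hs]
    refine setLIntegral_congr_fun measurableSet_Ioc fun x hx => ?_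
    simp only [abs_of_pos hx.1]
  have hneg : ∫⁻ x in Set.Ioc (-(1 / 2) : ℝ) 0, ENNReal.ofReal ((2 * |x|) ^ (-s)) =
      ENNReal.ofReal (1 / (1 - s) / 2) := by
    have h := (Measure.measurePreserving_neg (volume : Measure ℝ)).setLIntegral_comp_preimage_emb
      (MeasurableEquiv.neg ℝ).measurableEmbedding
      (fun x => ENNReal.ofReal ((2 * |x|) ^ (-s))) (Set.Ico 0 (1 / 2))
    simp only [abs_neg, Set.neg_preimage, Set.neg_Ico, neg_zero] at h
    rw [h, ← hpos]
    exact setLIntegral_congr Ico_ae_eq_Ioc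
  rw [← Set.Ioc_union_Ioc_eq_Ioc (b := (0 : ℝ)) (by norm_num) (by norm_num),
    lintegral_union measurableSet_Ioc (Set.Ioc_disjoint_Ioc_of_le le_rfl), hpos, hneg,
    ← ENNReal.ofReal_add]
  · congr 1; ring
  all_goals
    have : 0 < 1 - s := by linarith
    positivity

/-- A linear factor `w - z`, compared with its largest possible size `1 + |z|` on the circle, has
negative moments bounded uniformly in its root `z`. -/
theorem lintegral_enorm_toCircle_sub_rpow_neg_le {s : ℝ} (h0 : 0 ≤ s) (hs : s < 1) (z : ℂ) :
    ∫⁻ t : UnitAddCircle, ‖(AddCircle.toCircle t : ℂ) - z‖ₑ ^ (-s) ≤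
      ENNReal.ofReal (1 / (1 - s)) * (1 + ‖z‖ₑ) ^ (-s) := by
  -- After a rotation of the circle the root is the non-negative real number `‖z‖`.
  obtain ⟨φ, hφ⟩ : ∃ φ : UnitAddCircle, (AddCircle.toCircle φ : ℂ) * ‖z‖ = z := by
    obtain ⟨φ, hφ⟩ := (AddCircle.homeomorphCircle (one_ne_zero (α := ℝ))).surjective
      (Circle.exp (Complex.arg z))
    refine ⟨φ, ?_⟩
    rw [AddCircle.homeomorphCircle_apply] at hφ
    rw [hφ, Circle.coe_exp, mul_comm]
    exact Complex.norm_mul_exp_arg_mul_I z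
  rw [← lintegral_add_right_eq_self _ φ, ← UnitAddCircle.lintegral_preimage (-(1 / 2))]
  rw [show (-(1 / 2) + 1 : ℝ) = 1 / 2 by norm_num, ← setLIntegral_Ioc_two_mul_abs_rpow_neg hs,
    ← lintegral_mul_const' _ _ (by
      refine (ENNReal.rpow_ne_top_of_ne_zero ?_ ?_) <;> simp)]
  have hne : ∀ᵐ x : ℝ ∂(volume.restrict (Set.Ioc (-(1 / 2) : ℝ) (1 / 2))), x ≠ 0 :=
    ae_restrict_of_ae (Measure.ae_ne volume 0)
  refine lintegral_mono_ae ?_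
  filter_upwards [ae_restrict_mem measurableSet_Ioc, hne] with x hx hx0
  have hx' : |x| ≤ 1 / 2 := abs_le.2 ⟨hx.1.le, hx.2⟩
  have hpos : 0 < 2 * |x| := by positivity
  have key : ENNReal.ofReal (2 * |x|) * (1 + ‖z‖ₑ) ≤
      ‖(AddCircle.toCircle ((x : UnitAddCircle) + φ) : ℂ) - z‖ₑ := by
    have h1 : (AddCircle.toCircle ((x : UnitAddCircle) + φ) : ℂ) - z =
        ((Circle.exp (2 * Real.pi * x) : ℂ) - (‖z‖ : ℝ)) * (AddCircle.toCircle φ : ℂ) := by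
      rw [AddCircle.toCircle_add, AddCircle.toCircle_apply_mk, div_one, Circle.coe_mul, sub_mul]
      conv_lhs => rw [← hφ]
      ring
    have h2 := one_add_mul_abs_le_norm_circleExp_sub (norm_nonneg z) hx'
    rw [h1, enorm_mul, ← ofReal_norm (Circle.exp _ - _ : ℂ), ← ofReal_norm z,
      ← ofReal_norm (AddCircle.toCircle φ : ℂ), Circle.norm_coe, ENNReal.ofReal_one, mul_one,
      ← ENNReal.ofReal_one, ← ENNReal.ofReal_add zero_le_one (norm_nonneg z),
      ← ENNReal.ofReal_mul hpos.le, mul_comm]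
    exact ENNReal.ofReal_le_ofReal h2
  refine (ENNReal.rpow_neg_le_rpow_neg key h0).trans_eq ?_
  rw [ENNReal.mul_rpow_of_ne_top ENNReal.ofReal_ne_top (by simp),
    ENNReal.ofReal_rpow_of_pos hpos]

theorem Polynomial.enorm_eval_eq_prod_roots (p : Polynomial ℂ) (w : ℂ) :
    ‖p.eval w‖ₑ = ‖p.leadingCoeff‖ₑ * ∏ x : p.roots, ‖w - x.1‖ₑ := by
  conv_lhs => rw [(IsAlgClosed.splits p).eq_prod_roots]
  rw [Polynomial.eval_mul, Polynomial.eval_C, enorm_mul, Polynomial.eval_multiset_prod,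
    Multiset.map_map, ← Multiset.map_univ, Finset.prod_map_val]
  simp [enorm_eq_nnnorm, nnnorm_prod]

/-- On the circle, a negative moment of a polynomial of degree `D` is at most a constant times the
corresponding negative power of any of its values: by Hölder's inequality, the `D` linear factors
can be treated one at a time. -/
theorem Polynomial.lintegral_enorm_eval_rpow_neg_le {c s : ℝ} (hc : 0 < c) (hs : s < 1)
    (p : Polynomial ℂ) (hp : p.natDegree * c ≤ s) (w : Circle) :
    ∫⁻ t : UnitAddCircle, ‖p.eval (AddCircle.toCircle t : ℂ)‖ₑ ^ (-c) ≤
      ENNReal.ofReal (1 / (1 - s)) * ‖p.eval (w : ℂ)‖ₑ ^ (-c) := by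
  have hDc : 0 ≤ p.natDegree * c := by positivity
  have hB1 : 1 ≤ ENNReal.ofReal (1 / (1 - s)) := by
    rw [ENNReal.one_le_ofReal, le_div_iff₀] <;> linarith
  rcases Nat.eq_zero_or_pos p.natDegree with h0 | hD
  · obtain ⟨a, rfl⟩ := Polynomial.natDegree_eq_zero.1 h0
    simp only [Polynomial.eval_C, lintegral_const, UnitAddCircle.measure_univ, mul_one]
    exact le_mul_of_one_le_left' hB1
  have hne : p ≠ 0 := by rintro rfl; simp at hD
  have hcard : Fintype.card p.roots = p.natDegree := by
    rw [Multiset.card_coe, (IsAlgClosed.splits p).natDegree_eq_card_roots]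
  have hD' : (0 : ℝ) < p.natDegree := by exact_mod_cast hD
  set D : ℝ := (p.natDegree : ℝ) with hDdef
  have hlead : ‖p.leadingCoeff‖ₑ ^ (-c) ≠ ⊤ :=
    ENNReal.rpow_ne_top_of_ne_zero (by simpa using hne) enorm_ne_top
  have hpow : ∀ a : ENNReal, (a ^ (-(D * c))) ^ (1 / D) = a ^ (-c) := by
    intro a
    rw [← ENNReal.rpow_mul]
    congr 1
    field_simp
  have hsplit : ∀ v : ℂ, ‖p.eval v‖ₑ ^ (-c) =
      ‖p.leadingCoeff‖ₑ ^ (-c) * ∏ x : p.roots, (‖v - x.1‖ₑ ^ (-(D * c))) ^ (1 / D) := by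
    intro v
    rw [p.enorm_eval_eq_prod_roots, ENNReal.mul_rpow_of_ne_top enorm_ne_top
      (ENNReal.prod_ne_top fun _ _ => enorm_ne_top),
      ← ENNReal.prod_rpow_of_ne_top fun _ _ => enorm_ne_top]
    simp only [hpow]
  have hconst : ∏ _x : p.roots, (ENNReal.ofReal (1 / (1 - s))) ^ (1 / D) =
      ENNReal.ofReal (1 / (1 - s)) := by
    rw [Finset.prod_const, Finset.card_univ, hcard, ← ENNReal.rpow_natCast, ← ENNReal.rpow_mul,
      ← hDdef,
      one_div_mul_cancel hD'.ne', ENNReal.rpow_one]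
  have hmeas : ∀ x : ℂ, Measurable fun t : UnitAddCircle =>
      ‖(AddCircle.toCircle t : ℂ) - x‖ₑ ^ (-(D * c)) := by
    intro x
    have : Continuous fun t : UnitAddCircle => (AddCircle.toCircle t : ℂ) - x :=
      (continuous_subtype_val.comp AddCircle.continuous_toCircle).sub continuous_const
    exact this.measurable.enorm.pow_const _
  calc ∫⁻ t : UnitAddCircle, ‖p.eval (AddCircle.toCircle t : ℂ)‖ₑ ^ (-c)
      = ‖p.leadingCoeff‖ₑ ^ (-c) * ∫⁻ t : UnitAddCircle, ∏ x : p.roots,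
          (‖(AddCircle.toCircle t : ℂ) - x.1‖ₑ ^ (-(D * c))) ^ (1 / D) := by
        rw [← lintegral_const_mul' _ _ hlead]
        exact lintegral_congr fun t => hsplit _
    _ ≤ ‖p.leadingCoeff‖ₑ ^ (-c) * ∏ x : p.roots,
          (∫⁻ t : UnitAddCircle, ‖(AddCircle.toCircle t : ℂ) - x.1‖ₑ ^ (-(D * c))) ^ (1 / D) := by
        gcongr
        refine ENNReal.lintegral_prod_norm_pow_le _ (fun x _ => (hmeas x.1).aemeasurable) ?_
          (fun _ _ => by positivity)
        rw [Finset.sum_const, Finset.card_univ, hcard, nsmul_eq_mul, ← hDdef]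
        field_simp
    _ ≤ ‖p.leadingCoeff‖ₑ ^ (-c) * ∏ x : p.roots,
          (ENNReal.ofReal (1 / (1 - s)) * ‖(w : ℂ) - x.1‖ₑ ^ (-(D * c))) ^ (1 / D) := by
        gcongr with x
        refine (lintegral_enorm_toCircle_sub_rpow_neg_le hDc (hp.trans_lt hs) x.1).trans ?_
        gcongr ENNReal.ofReal ?_ * ?_
        · exact one_div_le_one_div_of_le (by linarith) (by linarith)
        · refine ENNReal.rpow_neg_le_rpow_neg ?_ hDc
          refine (enorm_sub_le).trans_eq ?_
          rw [← ofReal_norm (w : ℂ), Circle.norm_coe, ENNReal.ofReal_one]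
    _ = ENNReal.ofReal (1 / (1 - s)) * ‖p.eval (w : ℂ)‖ₑ ^ (-c) := by
        rw [hsplit w]
        simp_rw [ENNReal.mul_rpow_of_nonneg _ _ (one_div_nonneg.2 hD'.le)]
        rw [Finset.prod_mul_distrib, hconst]
        ring

/-! ### One-parameter unitary families and their products -/

/-- The element `1 + (w - 1) P` of `U(n)`, for `P` an orthogonal projection and `w` on the unit
circle: multiplication by `w` on the range of `P`, the identity on its orthogonal complement. -/
noncomputable def projPhase {n : ℕ} (P : {P : Matrix (Fin n) (Fin n) ℂ // IsStarProjection P})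
    (w : Circle) : UGroup n :=
  ⟨1 + ((w : ℂ) - 1) • (P : Matrix (Fin n) (Fin n) ℂ), by
    have hw : (starRingEnd ℂ) (w : ℂ) * w = 1 := by
      rw [← Circle.coe_inv_eq_conj, ← Circle.coe_mul, inv_mul_cancel, Circle.coe_one]
    rw [Matrix.mem_unitaryGroup_iff', star_add, star_one, star_smul,
      P.2.isSelfAdjoint.star_eq, add_mul, mul_add, mul_add, smul_mul_smul_comm,
      P.2.isIdempotentElem.eq, one_mul, one_mul, mul_one, add_assoc, ← add_smul, ← add_smul]
    have h0 : (w : ℂ) - 1 + (star ((w : ℂ) - 1) + star ((w : ℂ) - 1) * ((w : ℂ) - 1)) = 0 := by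
      rw [star_sub, star_one, Complex.star_def]
      linear_combination hw
    rw [h0, zero_smul, add_zero]⟩

section

variable {n : ℕ}

theorem coe_projPhase (P : {P : Matrix (Fin n) (Fin n) ℂ // IsStarProjection P}) (w : Circle) :
    (projPhase P w : Matrix (Fin n) (Fin n) ℂ) = 1 + ((w : ℂ) - 1) • P.1 := rfl

theorem projPhase_mul (P : {P : Matrix (Fin n) (Fin n) ℂ // IsStarProjection P}) (v w : Circle) :
    projPhase P v * projPhase P w = projPhase P (v * w) := by
  apply Subtype.ext
  simp only [Submonoid.coe_mul, coe_projPhase, Circle.coe_mul]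
  rw [add_mul, mul_add, mul_add, smul_mul_smul_comm, P.2.isIdempotentElem.eq, one_mul, one_mul,
    mul_one]
  module

theorem projPhase_one (P : {P : Matrix (Fin n) (Fin n) ℂ // IsStarProjection P}) :
    projPhase P 1 = 1 := by
  apply Subtype.ext
  simp [coe_projPhase]

theorem continuous_projPhase (P : {P : Matrix (Fin n) (Fin n) ℂ // IsStarProjection P}) :
    Continuous (projPhase P) := by
  refine Continuous.subtype_mk ?_ _
  have : Continuous fun w : Circle => (w : ℂ) := continuous_subtype_val
  fun_prop

open scoped Pointwise in
/-- The set of all products `projPhase P₁ w₁ * ⋯ * projPhase Pₖ wₖ`, for a fixed list of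
projections `P₁, …, Pₖ` and arbitrary phases. -/
def phaseProducts (L : List {P : Matrix (Fin n) (Fin n) ℂ // IsStarProjection P}) :
    Set (UGroup n) :=
  (L.map fun P => Set.range (projPhase P)).prod

theorem one_mem_phaseProducts_nil :
    (1 : UGroup n) ∈ phaseProducts (n := n) [] := by
  simp [phaseProducts]

theorem mem_phaseProducts_cons {P : {P : Matrix (Fin n) (Fin n) ℂ // IsStarProjection P}}
    {L : List {P : Matrix (Fin n) (Fin n) ℂ // IsStarProjection P}} {T : UGroup n} :
    T ∈ phaseProducts (P :: L) ↔ ∃ w, ∃ T' ∈ phaseProducts L, projPhase P w * T' = T := by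
  simp [phaseProducts, Set.mem_mul]

open scoped Pointwise in
theorem mul_mem_phaseProducts_append
    {L L' : List {P : Matrix (Fin n) (Fin n) ℂ // IsStarProjection P}} {T T' : UGroup n}
    (h : T ∈ phaseProducts L) (h' : T' ∈ phaseProducts L') :
    T * T' ∈ phaseProducts (L ++ L') := by
  rw [phaseProducts, List.map_append, List.prod_append]
  exact Set.mul_mem_mul h h'

theorem projPhase_mem_phaseProducts (P : {P : Matrix (Fin n) (Fin n) ℂ // IsStarProjection P})
    (w : Circle) : projPhase P w ∈ phaseProducts [P] :=
  mem_phaseProducts_cons.2 ⟨w, 1, one_mem_phaseProducts_nil, mul_one _⟩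

/-! ### Gaussian elimination by one-parameter families -/

/-- The projection onto the `i`-th coordinate axis. -/
def axisProj (i : Fin n) : {P : Matrix (Fin n) (Fin n) ℂ // IsStarProjection P} :=
  ⟨Matrix.single i i 1, by
    constructor
    · simp [IsIdempotentElem]
    · simp [IsSelfAdjoint, Matrix.star_eq_conjTranspose]⟩

/-- The projection onto the line spanned by `eᵢ + eⱼ`. -/
noncomputable def pairProj (i j : Fin n) (hij : i ≠ j) :
    {P : Matrix (Fin n) (Fin n) ℂ // IsStarProjection P} :=
  ⟨(1 / 2 : ℂ) • (Matrix.single i i 1 + Matrix.single j j 1 + Matrix.single i j 1 +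
      Matrix.single j i 1), by
    constructor
    · simp only [IsIdempotentElem, smul_mul_smul_comm, add_mul, mul_add,
        Matrix.single_mul_single_same, Matrix.single_mul_single_of_ne, hij, hij.symm, mul_one,
        ne_eq, not_false_eq_true, add_zero, zero_add]
      module
    · simp only [IsSelfAdjoint, Matrix.star_eq_conjTranspose, Matrix.conjTranspose_smul,
        Matrix.conjTranspose_add, Matrix.conjTranspose_single, star_one]
      simp only [star_div₀, star_one, star_ofNat]
      module⟩

theorem projPhase_axisProj_mul_apply_self (i : Fin n) (w : Circle) (V : UGroup n) (b : Fin n) :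
    (projPhase (axisProj i) w * V).1 i b = w * V.1 i b := by
  simp [coe_projPhase, axisProj, add_mul, Matrix.single_mul_apply_same]
  ring

theorem projPhase_axisProj_mul_apply_of_ne {i a : Fin n} (h : a ≠ i) (w : Circle) (V : UGroup n)
    (b : Fin n) : (projPhase (axisProj i) w * V).1 a b = V.1 a b := by
  simp [coe_projPhase, axisProj, add_mul, Matrix.single_mul_apply_of_ne, h]

theorem projPhase_pairProj_mul_apply_left {i j : Fin n} (hij : i ≠ j) (w : Circle) (V : UGroup n)
    (b : Fin n) : (projPhase (pairProj i j hij) w * V).1 i b =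
      V.1 i b + ((w : ℂ) - 1) / 2 * (V.1 i b + V.1 j b) := by
  simp [coe_projPhase, pairProj, add_mul, Matrix.single_mul_apply_same,
    Matrix.single_mul_apply_of_ne, hij]
  ring

theorem projPhase_pairProj_mul_apply_right {i j : Fin n} (hij : i ≠ j) (w : Circle) (V : UGroup n)
    (b : Fin n) : (projPhase (pairProj i j hij) w * V).1 j b =
      V.1 j b + ((w : ℂ) - 1) / 2 * (V.1 i b + V.1 j b) := by
  simp [coe_projPhase, pairProj, add_mul, Matrix.single_mul_apply_same,
    Matrix.single_mul_apply_of_ne, hij.symm]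
  ring

theorem projPhase_pairProj_mul_apply_of_ne {i j a : Fin n} (hij : i ≠ j) (hi : a ≠ i) (hj : a ≠ j)
    (w : Circle) (V : UGroup n) (b : Fin n) :
    (projPhase (pairProj i j hij) w * V).1 a b = V.1 a b := by
  simp [coe_projPhase, pairProj, add_mul, Matrix.single_mul_apply_of_ne, hi, hj]

end

section

variable {n : ℕ}

/-- Multiplying `V` by `projPhase (axisProj i) u` and then by `projPhase (pairProj i k _) w` turns
an entry `x` in row `i` of a column with entry `y` in row `k` into this combination, so that the
entry can be cleared. -/
theorem exists_phases_combination_eq_zero (x y : ℂ) :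
    ∃ u w : Circle, (u : ℂ) * x + ((w : ℂ) - 1) / 2 * (u * x + y) = 0 := by
  -- The phase `u` makes `u * x` orthogonal to `y` in the real plane.
  obtain ⟨u, hu⟩ : ∃ u : Circle, ‖y - u * x‖ = ‖y + u * x‖ := by
    refine ⟨Circle.exp (Complex.arg y - Complex.arg x + Real.pi / 2), ?_⟩
    have hx := Complex.norm_mul_exp_arg_mul_I x
    have hy := Complex.norm_mul_exp_arg_mul_I y
    generalize Complex.arg x = α at *
    generalize Complex.arg y = β at *
    have h : (Circle.exp (β - α + Real.pi / 2) : ℂ) * x =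
        Complex.exp (β * Complex.I) * (‖x‖ * Complex.I) := by
      rw [Circle.coe_exp]
      push_cast
      rw [add_mul, sub_mul, Complex.exp_add, Complex.exp_sub, Complex.exp_pi_div_two_mul_I,
        div_mul_eq_mul_div, div_mul_eq_mul_div, div_eq_iff (Complex.exp_ne_zero _)]
      linear_combination -Complex.exp (β * Complex.I) * Complex.I * hx
    rw [h, show y - Complex.exp (β * Complex.I) * (‖x‖ * Complex.I) =
        Complex.exp (β * Complex.I) * (‖y‖ - ‖x‖ * Complex.I) by linear_combination -hy,
      show y + Complex.exp (β * Complex.I) * (‖x‖ * Complex.I) =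
        Complex.exp (β * Complex.I) * (‖y‖ + ‖x‖ * Complex.I) by linear_combination -hy,
      norm_mul, norm_mul]
    congr 1
    rw [← sq_eq_sq₀ (norm_nonneg _) (norm_nonneg _), Complex.sq_norm, Complex.sq_norm]
    simp [Complex.normSq_apply]
  by_cases h0 : y + u * x = 0
  · refine ⟨u, 1, ?_⟩
    have h1 : y - u * x = 0 := by rw [← norm_eq_zero, hu, h0, norm_zero]
    simp only [Circle.coe_one]
    linear_combination (h0 - h1) / 2
  · refine ⟨u, ⟨(y - u * x) / (y + u * x), ?_⟩, ?_⟩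
    · refine mem_sphere_zero_iff_norm.2 ?_
      rw [norm_div, hu, div_self (norm_ne_zero_iff.2 h0)]
    · change (u : ℂ) * x + ((y - u * x) / (y + u * x) - 1) / 2 * (u * x + y) = 0
      field_simp
      ring

/-- If the first `k` columns of a unitary matrix are the first `k` basis vectors, then so are its
first `k` rows. -/
theorem UGroup.row_eq_of_col_eq {k : ℕ} {V : UGroup n}
    (hV : ∀ a b : Fin n, b.1 < k → V.1 a b = if a = b then 1 else 0) (a b : Fin n)
    (ha : a.1 < k) : V.1 a b = if a = b then 1 else 0 := by
  have h := congrFun (congrFun (Matrix.mem_unitaryGroup_iff'.1 V.2) a) b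
  rw [Matrix.mul_apply] at h
  simpa [Matrix.star_apply, hV _ a ha, Matrix.one_apply] using h

/-- Clearing the entries of the `k`-th column in the rows listed in `l`, with two one-parameter
families for each; zeros already present below the diagonal of that column are kept. -/
theorem exists_phaseProducts_clear_entries (k : Fin n) (l : List (Fin n)) (hl : ∀ i ∈ l, k < i) :
    ∃ L : List {P : Matrix (Fin n) (Fin n) ℂ // IsStarProjection P}, L.length = 2 * l.length ∧
      ∀ V : UGroup n, (∀ a b : Fin n, b.1 < k.1 → V.1 a b = if a = b then 1 else 0) →
        ∃ T ∈ phaseProducts L, ∃ V' : UGroup n, V = T * V' ∧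
          (∀ a b : Fin n, b.1 < k.1 → V'.1 a b = if a = b then 1 else 0) ∧
          ∀ i, k < i → i ∈ l ∨ V.1 i k = 0 → V'.1 i k = 0 := by
  induction l with
  | nil =>
    refine ⟨[], rfl, fun V hV => ⟨1, one_mem_phaseProducts_nil, V, (one_mul V).symm, hV, ?_⟩⟩
    simp
  | cons i l ih =>
    obtain ⟨L, hL, hLV⟩ := ih fun j hj => hl j (List.mem_cons_of_mem _ hj)
    have hki : k < i := hl i List.mem_cons_self
    refine ⟨axisProj i :: pairProj i k hki.ne' :: L, by simp [hL]; ring, fun V hV => ?_⟩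
    obtain ⟨u, w, huw⟩ := exists_phases_combination_eq_zero (V.1 i k) (V.1 k k)
    set V₁ : UGroup n := projPhase (axisProj i) u * V with hV₁
    set V₂ : UGroup n := projPhase (pairProj i k hki.ne') w * V₁ with hV₂
    have h1 : ∀ a b, a ≠ i → a ≠ k → V₂.1 a b = V.1 a b := fun a b hi hk => by
      rw [hV₂, projPhase_pairProj_mul_apply_of_ne _ hi hk, hV₁,
        projPhase_axisProj_mul_apply_of_ne hi]
    have h2 : ∀ b, V₂.1 i b = u * V.1 i b + ((w : ℂ) - 1) / 2 * (u * V.1 i b + V.1 k b) :=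
      fun b => by
        rw [hV₂, projPhase_pairProj_mul_apply_left, hV₁, projPhase_axisProj_mul_apply_self,
          projPhase_axisProj_mul_apply_of_ne hki.ne]
    have h3 : ∀ b, V₂.1 k b = V.1 k b + ((w : ℂ) - 1) / 2 * (u * V.1 i b + V.1 k b) :=
      fun b => by
        rw [hV₂, projPhase_pairProj_mul_apply_right, hV₁, projPhase_axisProj_mul_apply_self,
          projPhase_axisProj_mul_apply_of_ne hki.ne]
    have hcol : ∀ a b : Fin n, b.1 < k.1 → V₂.1 a b = if a = b then 1 else 0 := by
      intro a b hb
      have hbk : k ≠ b := (Fin.lt_def.2 hb).ne'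
      have hbi : i ≠ b := ((Fin.lt_def.2 hb).trans hki).ne'
      have hVi : V.1 i b = 0 := by rw [hV i b hb, if_neg hbi]
      have hVk : V.1 k b = 0 := by rw [hV k b hb, if_neg hbk]
      by_cases hi : a = i
      · rw [hi, h2, hVi, hVk, if_neg hbi]; simp
      by_cases hk : a = k
      · rw [hk, h3, hVi, hVk, if_neg hbk]; simp
      rw [h1 a b hi hk, hV a b hb]
    obtain ⟨T, hT, V', hV', hcol', hzero⟩ := hLV V₂ hcol
    refine ⟨projPhase (axisProj i) u⁻¹ * (projPhase (pairProj i k hki.ne') w⁻¹ * T), ?_, V', ?_,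
      hcol', fun j hj hjl => ?_⟩
    · exact mem_phaseProducts_cons.2 ⟨_, _, mem_phaseProducts_cons.2 ⟨_, T, hT, rfl⟩, rfl⟩
    · rw [mul_assoc, mul_assoc, ← hV', hV₂, ← mul_assoc (projPhase _ w⁻¹), projPhase_mul,
        inv_mul_cancel, projPhase_one, one_mul, hV₁, ← mul_assoc, projPhase_mul,
        inv_mul_cancel, projPhase_one, one_mul]
    · refine hzero j hj ?_
      by_cases hji : j = i
      · right; rw [hji, h2, huw]
      · rcases hjl with h | h
        · exact Or.inl ((List.mem_cons.1 h).resolve_left hji)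
        · right; rw [h1 j k hji hj.ne', h]

/-- Gaussian elimination: products of `3nk` fixed one-parameter families reach every possible value
of the first `k` columns of a unitary matrix. -/
theorem exists_phaseProducts_clear_columns (k : ℕ) (hk : k ≤ n) :
    ∃ L : List {P : Matrix (Fin n) (Fin n) ℂ // IsStarProjection P}, L.length ≤ 3 * n * k ∧
      ∀ V : UGroup n, ∃ T ∈ phaseProducts L, ∃ V' : UGroup n, V = T * V' ∧
        ∀ a b : Fin n, b.1 < k → V'.1 a b = if a = b then 1 else 0 := by
  induction k with
  | zero =>
    refine ⟨[], by simp, fun V => ⟨1, one_mem_phaseProducts_nil, V, (one_mul V).symm, ?_⟩⟩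
    simp
  | succ k ih =>
    obtain ⟨L, hL, hLV⟩ := ih (by omega)
    let k' : Fin n := ⟨k, by omega⟩
    set l : List (Fin n) := (List.finRange n).filter (k' < ·) with hl
    have hmem : ∀ i, i ∈ l ↔ k' < i := by simp [hl]
    have hlen : l.length ≤ n := (List.length_filter_le _ _).trans_eq (List.length_finRange)
    obtain ⟨M, hM, hMV⟩ := exists_phaseProducts_clear_entries k' l fun i hi => (hmem i).1 hi
    refine ⟨L ++ (M ++ [axisProj k']), ?_, fun V => ?_⟩
    · simp only [List.length_append, List.length_singleton, hM]
      nlinarith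
    obtain ⟨T, hT, V₁, rfl, h1⟩ := hLV V
    obtain ⟨S, hS, V₂, rfl, h2, h2'⟩ := hMV V₁ h1
    have hz : ∀ a, a ≠ k' → V₂.1 a k' = 0 := by
      intro a ha
      rcases lt_or_gt_of_ne ha with h | h
      · rw [UGroup.row_eq_of_col_eq h2 a k' h, if_neg ha]
      · exact h2' a h (Or.inl ((hmem a).2 h))
    have hu : (starRingEnd ℂ) (V₂.1 k' k') * V₂.1 k' k' = 1 := by
      have h := congrFun (congrFun (Matrix.mem_unitaryGroup_iff'.1 V₂.2) k') k'
      rw [Matrix.mul_apply, Finset.sum_eq_single k' (fun a _ ha => by simp [hz a ha]) (by simp)]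
        at h
      simpa [Matrix.star_apply] using h
    have hn : ‖V₂.1 k' k'‖ = 1 := by
      rw [← Complex.normSq_eq_conj_mul_self, Complex.normSq_eq_norm_sq] at hu
      have h : ‖V₂.1 k' k'‖ ^ 2 = 1 := by exact_mod_cast hu
      exact (pow_eq_one_iff_of_nonneg (norm_nonneg _) two_ne_zero).1 h
    let w : Circle := ⟨V₂.1 k' k', mem_sphere_zero_iff_norm.2 hn⟩
    have hw : (w : ℂ) = V₂.1 k' k' := rfl
    refine ⟨T * (S * projPhase (axisProj k') w), mul_mem_phaseProducts_append hT
      (mul_mem_phaseProducts_append hS (projPhase_mem_phaseProducts _ _)),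
      projPhase (axisProj k') w⁻¹ * V₂, ?_, fun a b hb => ?_⟩
    · rw [mul_assoc, mul_assoc, ← mul_assoc (projPhase _ w), projPhase_mul, mul_inv_cancel,
        projPhase_one, one_mul]
    · have hself : (w⁻¹ : Circle) * (w : ℂ) = 1 := by
        rw [← Circle.coe_mul, inv_mul_cancel, Circle.coe_one]
      rcases Nat.lt_succ_iff_lt_or_eq.1 hb with hb | hb
      · by_cases ha : a = k'
        · have hab : k' ≠ b := (Fin.lt_def.2 hb).ne'
          rw [ha, projPhase_axisProj_mul_apply_self, h2 _ _ hb, if_neg hab, mul_zero]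
        · rw [projPhase_axisProj_mul_apply_of_ne ha, h2 _ _ hb]
      · obtain rfl : b = k' := Fin.ext hb
        by_cases ha : a = k'
        · rw [ha, projPhase_axisProj_mul_apply_self, ← hw, hself, if_pos rfl]
        · rw [projPhase_axisProj_mul_apply_of_ne ha, hz a ha, if_neg ha]

/-- A fixed list of at most `3nm` one-parameter families suffices to move the first `m` columns of
any unitary matrix, by multiplication on the right, to those of any other one. -/
theorem exists_phaseProducts_firstCols_eq {m : ℕ} (h : m ≤ n) :
    ∃ L : List {P : Matrix (Fin n) (Fin n) ℂ // IsStarProjection P}, L.length ≤ 3 * n * m ∧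
      ∀ U U₀ : UGroup n, ∃ T ∈ phaseProducts L, firstCols h (U * T) = firstCols h U₀ := by
  obtain ⟨L, hL, hLV⟩ := exists_phaseProducts_clear_columns m h
  refine ⟨L, hL, fun U U₀ => ?_⟩
  obtain ⟨T, hT, V', hV', hcol⟩ := hLV (U⁻¹ * U₀)
  refine ⟨T, hT, funext fun ⟨a, b⟩ => ?_⟩
  have hU : U₀.1 = (U * T).1 * V'.1 := by
    rw [← Submonoid.coe_mul, mul_assoc, ← hV', mul_inv_cancel_left]
  change (U * T).1 a _ = U₀.1 a _
  rw [hU, Matrix.mul_apply]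
  simp [hcol _ (Fin.castLE h b) b.2]

end

/-! ### Trigonometric polynomials on the circle -/

/-- A function on the unit circle that is a Laurent polynomial in `w` with exponents between `-D`
and `D`. -/
def IsTrigPolynomial (D : ℕ) (q : Circle → ℂ) : Prop :=
  ∃ p : Polynomial ℂ, p.natDegree ≤ 2 * D ∧ ∀ w : Circle, (w : ℂ) ^ D * q w = p.eval (w : ℂ)

namespace IsTrigPolynomial

theorem mono {D E : ℕ} {q : Circle → ℂ} (h : IsTrigPolynomial D q) (hDE : D ≤ E) :
    IsTrigPolynomial E q := by
  obtain ⟨p, hp, hq⟩ := h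
  refine ⟨Polynomial.X ^ (E - D) * p, ?_, fun w => ?_⟩
  · refine Polynomial.natDegree_mul_le.trans ?_
    rw [Polynomial.natDegree_X_pow]
    omega
  · rw [Polynomial.eval_mul, Polynomial.eval_pow, Polynomial.eval_X, ← hq, ← mul_assoc, ← pow_add,
      Nat.sub_add_cancel hDE]

theorem const (a : ℂ) : IsTrigPolynomial 0 fun _ => a :=
  ⟨Polynomial.C a, by simp, by simp⟩

theorem affine (a b : ℂ) : IsTrigPolynomial 1 fun w => a + b * w :=
  ⟨Polynomial.X * (Polynomial.C a + Polynomial.C b * Polynomial.X), by compute_degree, by simp⟩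

theorem conj_affine (a b : ℂ) :
    IsTrigPolynomial 1 fun w => (starRingEnd ℂ) (a + b * (w : ℂ)) := by
  refine ⟨Polynomial.C ((starRingEnd ℂ) a) * Polynomial.X + Polynomial.C ((starRingEnd ℂ) b),
    (Polynomial.natDegree_linear_le).trans one_le_two, fun w => ?_⟩
  have hw : (w : ℂ) * (starRingEnd ℂ) (w : ℂ) = 1 := by
    rw [← Circle.coe_inv_eq_conj, ← Circle.coe_mul, mul_inv_cancel, Circle.coe_one]
  simp only [map_add, map_mul, Polynomial.eval_add, Polynomial.eval_mul, Polynomial.eval_C,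
    Polynomial.eval_X, pow_one]
  linear_combination (starRingEnd ℂ) b * hw

theorem mul {D E : ℕ} {q r : Circle → ℂ} (hq : IsTrigPolynomial D q) (hr : IsTrigPolynomial E r) :
    IsTrigPolynomial (D + E) fun w => q w * r w := by
  obtain ⟨p, hp, hp'⟩ := hq
  obtain ⟨p₂, hp₂, hp₂'⟩ := hr
  refine ⟨p * p₂, Polynomial.natDegree_mul_le.trans (by omega), fun w => ?_⟩
  rw [Polynomial.eval_mul, ← hp', ← hp₂']
  ring

theorem pow {D : ℕ} {q : Circle → ℂ} (hq : IsTrigPolynomial D q) (k : ℕ) :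
    IsTrigPolynomial (k * D) fun w => q w ^ k := by
  induction k with
  | zero => simpa using const 1
  | succ k ih => simpa only [pow_succ, Nat.succ_mul] using ih.mul hq

theorem prod {ι : Type*} (s : Finset ι) {D : ι → ℕ} {q : ι → Circle → ℂ}
    (hq : ∀ i ∈ s, IsTrigPolynomial (D i) (q i)) :
    IsTrigPolynomial (∑ i ∈ s, D i) fun w => ∏ i ∈ s, q i w := by
  classical
  induction s using Finset.induction_on with
  | empty => simpa using const 1
  | insert i s hi ih =>
    simp only [Finset.prod_insert hi, Finset.sum_insert hi]
    exact (hq i (Finset.mem_insert_self i s)).mul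
      (ih fun j hj => hq j (Finset.mem_insert_of_mem hj))

theorem sum {ι : Type*} (s : Finset ι) {D : ℕ} {q : ι → Circle → ℂ}
    (hq : ∀ i ∈ s, IsTrigPolynomial D (q i)) :
    IsTrigPolynomial D fun w => ∑ i ∈ s, q i w := by
  choose! p hp hp' using hq
  refine ⟨∑ i ∈ s, p i, Polynomial.natDegree_sum_le_of_forall_le s p hp, fun w => ?_⟩
  rw [Polynomial.eval_finsetSum, Finset.mul_sum]
  exact Finset.sum_congr rfl fun i hi => hp' i hi w

/-- Substituting trigonometric polynomials of degree one into a polynomial of total degree at most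
`d` gives a trigonometric polynomial of degree `d`. -/
theorem eval {σ : Type*} {d : ℕ} {p : MvPolynomial σ ℂ} (hp : p.totalDegree ≤ d)
    {x : Circle → σ → ℂ} (hx : ∀ s, IsTrigPolynomial 1 fun w => x w s) :
    IsTrigPolynomial d fun w => MvPolynomial.eval (x w) p := by
  simp only [MvPolynomial.eval_eq]
  refine sum _ fun e he => ?_
  have h : IsTrigPolynomial (∑ i ∈ e.support, e i * 1) fun w => ∏ i ∈ e.support, x w i ^ e i :=
    prod _ fun i _ => (hx i).pow (e i)
  refine ((const (p.coeff e)).mul h).mono ?_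
  simpa [Finsupp.sum] using (MvPolynomial.le_totalDegree he).trans hp

theorem lintegral_enorm_rpow_neg_le {D : ℕ} {q : Circle → ℂ} (hq : IsTrigPolynomial D q)
    {c s : ℝ} (hc : 0 < c) (hs : s < 1) (hD : 2 * D * c ≤ s) (w : Circle) :
    ∫⁻ t : UnitAddCircle, ‖q (AddCircle.toCircle t)‖ₑ ^ (-c) ≤
      ENNReal.ofReal (1 / (1 - s)) * ‖q w‖ₑ ^ (-c) := by
  obtain ⟨p, hp, hpq⟩ := hq
  have h : ∀ v : Circle, ‖q v‖ₑ = ‖p.eval (v : ℂ)‖ₑ := fun v => by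
    rw [← hpq, enorm_mul, enorm_pow, ← ofReal_norm (v : ℂ), Circle.norm_coe, ENNReal.ofReal_one,
      one_pow, one_mul]
  simp only [h]
  refine p.lintegral_enorm_eval_rpow_neg_le hc hs (le_trans ?_ hD) w
  have hp' : (p.natDegree : ℝ) ≤ 2 * D := by exact_mod_cast hp
  exact mul_le_mul_of_nonneg_right hp' hc.le

end IsTrigPolynomial

/-! ### Negative moments on the unitary group -/

instance UGroup.instSecondCountableTopology (n : ℕ) : SecondCountableTopology (UGroup n) :=
  have : SecondCountableTopology (Matrix (Fin n) (Fin n) ℂ) :=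
    inferInstanceAs (SecondCountableTopology (Fin n → Fin n → ℂ))
  TopologicalSpace.Subtype.secondCountableTopology _

/-- The group `U(n)` is compact, hence unimodular. -/
instance haarU.instIsMulRightInvariant (n : ℕ) : (haarU n).IsMulRightInvariant where
  map_mul_right_eq_self g := by
    have : IsProbabilityMeasure (Measure.map (· * g) (haarU n)) :=
      Measure.isProbabilityMeasure_map (measurable_mul_const g).aemeasurable
    exact Measure.isHaarMeasure_eq_of_isProbabilityMeasure _ _

section

variable {n : ℕ}

/-- Multiplying a Haar distributed `U` by independent random elements of the families
`projPhase P`, for `P` in the list `L`, does not change its distribution; the function `ψ` is the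
conditional expectation of `‖f‖ ^ (-c)` given `U`. When `f` is a trigonometric polynomial along
each family, integrating out one phase at a time bounds `ψ U` by any value at `U * T`. -/
theorem exists_lintegral_eq_and_le_of_isTrigPolynomial {D : ℕ} {f : UGroup n → ℂ}
    (hf : Measurable f)
    (htrig : ∀ (U W : UGroup n) (P : {P : Matrix (Fin n) (Fin n) ℂ // IsStarProjection P}),
      IsTrigPolynomial D fun w => f (U * projPhase P w * W))
    {c s : ℝ} (hc : 0 < c) (hs : s < 1) (hD : 2 * D * c ≤ s)
    (L : List {P : Matrix (Fin n) (Fin n) ℂ // IsStarProjection P}) :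
    ∃ ψ : UGroup n → ENNReal, Measurable ψ ∧
      ∫⁻ U, ψ U ∂(haarU n) = ∫⁻ U, ‖f U‖ₑ ^ (-c) ∂(haarU n) ∧
      ∀ U, ∀ T ∈ phaseProducts L,
        ψ U ≤ ENNReal.ofReal (1 / (1 - s)) ^ L.length * ‖f (U * T)‖ₑ ^ (-c) := by
  induction L with
  | nil =>
    refine ⟨fun U => ‖f U‖ₑ ^ (-c), hf.enorm.pow_const _, rfl, fun U T hT => ?_⟩
    obtain rfl : T = 1 := by simpa [phaseProducts] using hT
    simp
  | cons P L ih =>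
    obtain ⟨ψ, hψ, hint, hle⟩ := ih
    have hmeas : Measurable fun x : UGroup n × UnitAddCircle =>
        ψ (x.1 * projPhase P (AddCircle.toCircle x.2)) := by
      have hP := continuous_projPhase P
      have ht := AddCircle.continuous_toCircle (T := 1)
      exact hψ.comp (measurable_fst.mul ((hP.comp ht).measurable.comp measurable_snd))
    refine ⟨fun U => ∫⁻ t : UnitAddCircle, ψ (U * projPhase P (AddCircle.toCircle t)),
      hmeas.lintegral_prod_right', ?_, fun U T hT => ?_⟩
    · rw [lintegral_lintegral_swap hmeas.aemeasurable]
      simp only [lintegral_mul_right_eq_self ψ]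
      rw [lintegral_const, UnitAddCircle.measure_univ, mul_one, hint]
    · obtain ⟨w, T', hT', rfl⟩ := mem_phaseProducts_cons.1 hT
      have hB : ENNReal.ofReal (1 / (1 - s)) ^ L.length ≠ ⊤ :=
        ENNReal.pow_ne_top ENNReal.ofReal_ne_top
      calc ∫⁻ t : UnitAddCircle, ψ (U * projPhase P (AddCircle.toCircle t))
          ≤ ∫⁻ t : UnitAddCircle, ENNReal.ofReal (1 / (1 - s)) ^ L.length *
              ‖f (U * projPhase P (AddCircle.toCircle t) * T')‖ₑ ^ (-c) :=
            lintegral_mono fun t => hle _ T' hT'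
        _ = ENNReal.ofReal (1 / (1 - s)) ^ L.length * ∫⁻ t : UnitAddCircle,
              ‖f (U * projPhase P (AddCircle.toCircle t) * T')‖ₑ ^ (-c) :=
            lintegral_const_mul' _ _ hB
        _ ≤ ENNReal.ofReal (1 / (1 - s)) ^ L.length * (ENNReal.ofReal (1 / (1 - s)) *
              ‖f (U * projPhase P w * T')‖ₑ ^ (-c)) := by
            gcongr
            exact (htrig U T' P).lintegral_enorm_rpow_neg_le hc hs hD w
        _ = _ := by
            rw [List.length_cons, pow_succ, mul_assoc U, mul_assoc]

theorem continuous_firstCols {m : ℕ} (h : m ≤ n) : Continuous (firstCols h : UGroup n → _) :=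
  continuous_pi fun ij =>
    continuous_subtype_val.matrix_elem ij.1 (Fin.castLE h ij.2)

theorem IsSemiPolynomial.continuous {σ : Type*} {d : ℕ} {F : (σ → ℂ) → ℂ}
    (hF : IsSemiPolynomial d F) : Continuous F := by
  obtain ⟨p, -, hp⟩ := hF
  rw [funext hp]
  refine p.continuous_eval.comp (continuous_pi ?_)
  rintro (i | i)
  · exact continuous_apply i
  · exact Complex.continuous_conj.comp (continuous_apply i)

theorem IsSemiPolynomial.isTrigPolynomial {m d : ℕ} (h : m ≤ n) {F : (Fin n × Fin m → ℂ) → ℂ}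
    (hF : IsSemiPolynomial d F) (U W : UGroup n)
    (P : {P : Matrix (Fin n) (Fin n) ℂ // IsStarProjection P}) :
    IsTrigPolynomial d fun w => F (firstCols h (U * projPhase P w * W)) := by
  obtain ⟨p, hpd, hp⟩ := hF
  simp only [hp]
  have hentry : ∀ ij : Fin n × Fin m, ∃ a b : ℂ, ∀ w : Circle,
      firstCols h (U * projPhase P w * W) ij = a + b * w := by
    intro ij
    refine ⟨(U.1 * W.1 - U.1 * P.1 * W.1) ij.1 (Fin.castLE h ij.2),
      (U.1 * P.1 * W.1) ij.1 (Fin.castLE h ij.2), fun w => ?_⟩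
    have : (U * projPhase P w * W).1 =
        U.1 * W.1 - U.1 * P.1 * W.1 + (w : ℂ) • (U.1 * P.1 * W.1) := by
      simp only [Submonoid.coe_mul, coe_projPhase, mul_add, add_mul, mul_one, Matrix.mul_smul,
        Matrix.smul_mul]
      module
    simp only [firstCols, this, Matrix.add_apply, Matrix.smul_apply, smul_eq_mul]
    ring
  choose a b hab using hentry
  refine IsTrigPolynomial.eval hpd ?_
  rintro (i | i)
  · simpa only [Sum.elim_inl, hab] using IsTrigPolynomial.affine (a i) (b i)
  · simpa only [Sum.elim_inr, hab] using IsTrigPolynomial.conj_affine (a i) (b i)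

/-- The negative moment of order `1 / (4nmd)` of a semi-polynomial in the first `m` columns is at
most an absolute constant times the negative power of any of its values. -/
theorem IsSemiPolynomial.lintegral_enorm_rpow_neg_le {m d : ℕ} (hm : 1 ≤ m) (h : m ≤ n)
    (hd : 1 ≤ d) {F : (Fin n × Fin m → ℂ) → ℂ} (hF : IsSemiPolynomial d F) (U₀ : UGroup n) :
    ∫⁻ U, ‖F (firstCols h U)‖ₑ ^ (-(1 / (4 * n * m * d) : ℝ)) ∂(haarU n) ≤
      ENNReal.ofReal (Real.exp 3) * ‖F (firstCols h U₀)‖ₑ ^ (-(1 / (4 * n * m * d) : ℝ)) := by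
  have hn' : (1 : ℝ) ≤ n := by exact_mod_cast hm.trans h
  have hm' : (1 : ℝ) ≤ m := by exact_mod_cast hm
  have hd' : (1 : ℝ) ≤ d := by exact_mod_cast hd
  have hnm : (1 : ℝ) ≤ n * m := one_le_mul_of_one_le_of_one_le hn' hm'
  set c : ℝ := 1 / (4 * n * m * d) with hc
  set s : ℝ := 1 / (2 * (n * m)) with hs
  have hs2 : s ≤ 1 / 2 := by
    rw [hs]
    exact one_div_le_one_div_of_le (by norm_num) (by linarith)
  obtain ⟨L, hL, hLU⟩ := exists_phaseProducts_firstCols_eq h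
  obtain ⟨ψ, -, hint, hle⟩ := exists_lintegral_eq_and_le_of_isTrigPolynomial
    (f := fun U => F (firstCols h U))
    (hF.continuous.comp (continuous_firstCols h)).measurable (hF.isTrigPolynomial h)
    (c := c) (s := s) (by positivity) (by linarith)
    (le_of_eq (by rw [hc, hs]; field_simp; norm_num)) L
  -- The constant is `(1 - s)⁻¹ ^ k` with `s = 1 / (2nm)` and `k ≤ 3nm`.
  have hconst : ENNReal.ofReal (1 / (1 - s)) ^ L.length ≤ ENNReal.ofReal (Real.exp 3) := by
    have hs0 : 0 < s := by positivity
    have h1 : 1 / (1 - s) ≤ Real.exp (2 * s) := by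
      refine le_trans ?_ (Real.add_one_le_exp _)
      rw [div_le_iff₀ (by linarith)]
      nlinarith
    rw [← ENNReal.ofReal_pow (by rw [one_div_nonneg]; linarith)]
    refine ENNReal.ofReal_le_ofReal
      ((pow_le_pow_left₀ (by rw [one_div_nonneg]; linarith) h1 _).trans ?_)
    rw [← Real.exp_nat_mul]
    refine Real.exp_le_exp.2 ?_
    have hL' : (L.length : ℝ) ≤ 3 * n * m := by exact_mod_cast hL
    refine (mul_le_mul_of_nonneg_right hL' (by positivity)).trans_eq ?_
    rw [hs]
    field_simp
  rw [← hint]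
  calc ∫⁻ U, ψ U ∂(haarU n)
      ≤ ∫⁻ _U, ENNReal.ofReal (Real.exp 3) * ‖F (firstCols h U₀)‖ₑ ^ (-c) ∂(haarU n) := by
        refine lintegral_mono fun U => ?_
        obtain ⟨T, hT, hTU⟩ := hLU U U₀
        refine (hle U T hT).trans ?_
        rw [hTU]
        gcongr
    _ = _ := by rw [lintegral_const, measure_univ, mul_one]

end

/-! ### Small-ball estimates -/

theorem measureReal_le_mul_integral_le_of_semiPolynomial {n m d : ℕ} (hm : 1 ≤ m) (h : m ≤ n)
    (hd : 1 ≤ d) {F : (Fin n × Fin m → ℂ) → ℂ} (hF : IsSemiPolynomial d F)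
    (hreal : ∀ U : UGroup n, (F (firstCols h U)).im = 0 ∧ 0 ≤ (F (firstCols h U)).re)
    (hne : ∃ U : UGroup n, F (firstCols h U) ≠ 0) {ε : ℝ} (hε : 0 < ε) :
    (haarU n).real {U : UGroup n |
        (F (firstCols h U)).re ≤ ε * ∫ V : UGroup n, (F (firstCols h V)).re ∂(haarU n)} ≤
      Real.exp 3 * ε ^ (1 / (4 * n * m * d) : ℝ) := by
  have hcont : Continuous fun U : UGroup n => (F (firstCols h U)).re :=
    Complex.continuous_re.comp (hF.continuous.comp (continuous_firstCols h))
  have hn' : (1 : ℝ) ≤ n := by exact_mod_cast hm.trans h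
  have hm' : (1 : ℝ) ≤ m := by exact_mod_cast hm
  have hd' : (1 : ℝ) ≤ d := by exact_mod_cast hd
  have henorm : ∀ U : UGroup n, ‖F (firstCols h U)‖ₑ = ENNReal.ofReal (F (firstCols h U)).re := by
    intro U
    have : F (firstCols h U) = ((F (firstCols h U)).re : ℂ) := by
      apply Complex.ext <;> simp [(hreal U).1]
    rw [this, ← ofReal_norm, Complex.norm_real, Real.norm_of_nonneg (hreal U).2, Complex.ofReal_re]
  -- The mean of `F` is at most its maximum `M`, attained at `U₀`.
  obtain ⟨U₀, -, hmax⟩ := isCompact_univ.exists_isMaxOn Set.univ_nonempty hcont.continuousOn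
  have hmax' : ∀ U : UGroup n, (F (firstCols h U)).re ≤ (F (firstCols h U₀)).re :=
    fun U => hmax (Set.mem_univ U)
  set M : ℝ := (F (firstCols h U₀)).re with hM
  have hMpos : 0 < M := by
    obtain ⟨U, hU⟩ := hne
    refine lt_of_lt_of_le (lt_of_le_of_ne (hreal U).2 fun h0 => hU ?_) (hmax' U)
    exact Complex.ext h0.symm (hreal U).1
  have hmean : ∫ V : UGroup n, (F (firstCols h V)).re ∂(haarU n) ≤ M := by
    have hint : Integrable (fun U : UGroup n => (F (firstCols h U)).re) (haarU n) :=
      hcont.integrable_of_hasCompactSupport (HasCompactSupport.of_compactSpace _)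
    refine (integral_mono hint (integrable_const M) hmax').trans_eq ?_
    simp
  set c : ℝ := 1 / (4 * n * m * d) with hc
  have hcpos : 0 < c := by positivity
  have hmoment := hF.lintegral_enorm_rpow_neg_le hm h hd U₀
  rw [← hc] at hmoment
  simp only [henorm, ← hM] at hmoment
  have hεM : 0 < ε * M := by positivity
  have hsub : {U : UGroup n |
      (F (firstCols h U)).re ≤ ε * ∫ V : UGroup n, (F (firstCols h V)).re ∂(haarU n)} ⊆
      {U : UGroup n | ENNReal.ofReal (ε * M) ^ (-c) ≤
        ENNReal.ofReal (F (firstCols h U)).re ^ (-c)} := by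
    intro U hU
    exact ENNReal.rpow_neg_le_rpow_neg (ENNReal.ofReal_le_ofReal
      (le_trans hU (mul_le_mul_of_nonneg_left hmean hε.le))) hcpos.le
  have hmeas : Measurable fun U : UGroup n => ENNReal.ofReal (F (firstCols h U)).re ^ (-c) :=
    hcont.measurable.ennreal_ofReal.pow_const _
  have hmarkov := meas_ge_le_lintegral_div (μ := haarU n) hmeas.aemeasurable
    (ε := ENNReal.ofReal (ε * M) ^ (-c))
    (by rw [ENNReal.ofReal_rpow_of_pos hεM]; simpa using Real.rpow_pos_of_pos hεM _)
    (by rw [ENNReal.ofReal_rpow_of_pos hεM]; exact ENNReal.ofReal_ne_top)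
  have hbound : haarU n {U : UGroup n |
      (F (firstCols h U)).re ≤ ε * ∫ V : UGroup n, (F (firstCols h V)).re ∂(haarU n)} ≤
      ENNReal.ofReal (Real.exp 3 * ε ^ c) := by
    refine (measure_mono hsub).trans (hmarkov.trans ?_)
    refine (ENNReal.div_le_div_right hmoment _).trans_eq ?_
    rw [ENNReal.ofReal_rpow_of_pos hεM, ENNReal.ofReal_rpow_of_pos hMpos,
      ← ENNReal.ofReal_mul (Real.exp_pos 3).le,
      ← ENNReal.ofReal_div_of_pos (Real.rpow_pos_of_pos hεM _)]
    congr 1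
    rw [Real.mul_rpow hε.le hMpos.le, Real.rpow_neg hε.le]
    have := (Real.rpow_pos_of_pos hMpos (-c)).ne'
    field_simp
  exact ENNReal.toReal_le_of_le_ofReal (by positivity) hbound

/-- The squared modulus of a polynomial of degree at most `d` in the entries of `U` and `U†` is a
semi-polynomial of degree at most `2 * d` in the entries of `U`. -/
theorem exists_isSemiPolynomial_norm_evalUUdag_sq {n d : ℕ}
    (p : MvPolynomial ((Fin n × Fin n) ⊕ (Fin n × Fin n)) ℂ) (hp : p.totalDegree ≤ d) :
    ∃ F : (Fin n × Fin n → ℂ) → ℂ, IsSemiPolynomial (2 * d) F ∧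
      ∀ U : UGroup n, F (firstCols le_rfl U) = ((‖evalUUdag p U‖ ^ 2 : ℝ) : ℂ) := by
  -- `q` is `p` in the variables `z, z̄`, and `q'` is its complex conjugate.
  set q := MvPolynomial.rename (Sum.map id Prod.swap) p with hq
  set q' := MvPolynomial.rename Sum.swap (MvPolynomial.map (starRingEnd ℂ) q) with hq'
  have hqd : q.totalDegree ≤ d := (MvPolynomial.totalDegree_rename_le _ _).trans hp
  have hq'd : q'.totalDegree ≤ d :=
    (MvPolynomial.totalDegree_rename_le _ _).trans
      ((Finset.sup_mono (MvPolynomial.support_map_subset _ _)).trans hqd)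
  refine ⟨fun z => MvPolynomial.eval (Sum.elim z fun s => (starRingEnd ℂ) (z s)) (q * q'),
    ⟨q * q', (MvPolynomial.totalDegree_mul _ _).trans (by omega), fun _ => rfl⟩, fun U => ?_⟩
  set x := Sum.elim (firstCols le_rfl U) fun s => (starRingEnd ℂ) (firstCols le_rfl U s) with hx
  have h1 : MvPolynomial.eval x q = evalUUdag p U := by
    rw [hq, MvPolynomial.eval_rename, evalUUdag]
    congr 2
    funext i
    rcases i with i | i <;> rfl
  have h2 : MvPolynomial.eval x q' = (starRingEnd ℂ) (MvPolynomial.eval x q) := by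
    rw [hq', MvPolynomial.eval_rename, MvPolynomial.eval_map]
    have hconj : x ∘ Sum.swap = (starRingEnd ℂ) ∘ x := by
      funext i
      rcases i with i | i <;> simp [hx]
    rw [hconj]
    exact (MvPolynomial.eval₂_comp_left (starRingEnd ℂ) (RingHom.id ℂ) x q).symm
  simp only [map_mul]
  rw [h2, h1, Complex.mul_conj, Complex.normSq_eq_norm_sq]

theorem IsSemiPolynomial.firstCols_eq_of_mul_eq_zero {n m d : ℕ} (h : m ≤ n) (h0 : n * m * d = 0)
    {F : (Fin n × Fin m → ℂ) → ℂ} (hF : IsSemiPolynomial d F) (U V : UGroup n) :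
    F (firstCols h U) = F (firstCols h V) := by
  rcases Nat.mul_eq_zero.1 h0 with h1 | h1
  · have : IsEmpty (Fin n × Fin m) := by
      rcases Nat.mul_eq_zero.1 h1 with rfl | rfl <;> infer_instance
    rw [Subsingleton.elim (firstCols h U) (firstCols h V)]
  · subst h1
    obtain ⟨p, hp, hpF⟩ := hF
    rw [hpF, hpF, MvPolynomial.totalDegree_eq_zero_iff_eq_C.1 (Nat.le_zero.1 hp)]
    simp

theorem mainTheorem1 :
    ∃ C C' : ℕ → ℕ → ℕ → ℝ,
      (∀ n m d : ℕ, 0 < C n m d ∧ 0 < C' n m d) ∧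
      -- explicit constants
      (∀ n m d : ℕ, 1 ≤ m → m ≤ n → 1 ≤ d →
        C n m d = 1 / (4 * (n : ℝ) * (m : ℝ) * (d : ℝ))) ∧
      (∃ K : ℝ, ∀ n m d : ℕ, 1 ≤ m → m ≤ n → 1 ≤ d →
        C' n m d ≤ K * ((n : ℝ) ^ 2 * (m : ℝ) * (d : ℝ))) ∧
      -- non-negative semi-polynomials in the first `m` columns
      (∀ (n m d : ℕ) (h : m ≤ n) (F : (Fin n × Fin m → ℂ) → ℂ),
        IsSemiPolynomial d F →
        (∀ U : UGroup n, (F (firstCols h U)).im = 0 ∧ 0 ≤ (F (firstCols h U)).re) →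
        (∃ U : UGroup n, F (firstCols h U) ≠ 0) →
        ∀ ε : ℝ, 0 < ε →
          (haarU n).real {U : UGroup n |
              (F (firstCols h U)).re ≤ ε * ∫ V : UGroup n, (F (firstCols h V)).re ∂(haarU n)}
            ≤ C' n m d * ε ^ (C n m d)) ∧
      -- arbitrary polynomials in the entries of `U` and `U†`
      (∀ (n d : ℕ) (p : MvPolynomial ((Fin n × Fin n) ⊕ (Fin n × Fin n)) ℂ),
        p.totalDegree ≤ d →
        (∃ U : UGroup n, evalUUdag p U ≠ 0) →
        ∀ ε : ℝ, 0 < ε →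
          (haarU n).real {U : UGroup n |
              ‖evalUUdag p U‖ ^ 2 ≤ ε * ∫ V : UGroup n, ‖evalUUdag p V‖ ^ 2 ∂(haarU n)}
            ≤ C' n n (2 * d) * ε ^ (C n n (2 * d))) := by
  set C : ℕ → ℕ → ℕ → ℝ := fun n m d =>
    if n * m * d = 0 then 1 else 1 / (4 * (n : ℝ) * (m : ℝ) * (d : ℝ)) with hC
  have hmain : ∀ (n m d : ℕ) (h : m ≤ n) (F : (Fin n × Fin m → ℂ) → ℂ),
      IsSemiPolynomial d F →
      (∀ U : UGroup n, (F (firstCols h U)).im = 0 ∧ 0 ≤ (F (firstCols h U)).re) →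
      (∃ U : UGroup n, F (firstCols h U) ≠ 0) →
      ∀ ε : ℝ, 0 < ε →
        (haarU n).real {U : UGroup n |
            (F (firstCols h U)).re ≤ ε * ∫ V : UGroup n, (F (firstCols h V)).re ∂(haarU n)}
          ≤ Real.exp 3 * ε ^ (C n m d) := by
    intro n m d h F hF hreal hne ε hε
    by_cases h0 : n * m * d = 0
    · -- `F` is a positive constant on `U(n)`: the event is empty unless `ε ≥ 1`.
      simp only [hC, if_pos h0, Real.rpow_one]
      obtain ⟨U₀, hU₀⟩ := hne
      have hconst : ∀ U : UGroup n, F (firstCols h U) = F (firstCols h U₀) :=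
        fun U => hF.firstCols_eq_of_mul_eq_zero h h0 U U₀
      have hpos : 0 < (F (firstCols h U₀)).re :=
        lt_of_le_of_ne (hreal U₀).2 fun h1 => hU₀ (Complex.ext h1.symm (hreal U₀).1)
      simp only [hconst, integral_const, probReal_univ, one_smul]
      rcases le_or_gt 1 ε with h1 | h1
      · refine measureReal_le_one.trans ?_
        exact one_le_mul_of_one_le_of_one_le (Real.one_le_exp (by norm_num)) h1
      · have hnot : ¬ (F (firstCols h U₀)).re ≤ ε * (F (firstCols h U₀)).re := by
          rw [not_le]; nlinarith
        simp only [hnot, Set.ofPred_false, measureReal_empty]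
        positivity
    · simp only [hC, if_neg h0]
      have hm : 1 ≤ m := Nat.one_le_iff_ne_zero.2 (by rintro rfl; simp at h0)
      have hd : 1 ≤ d := Nat.one_le_iff_ne_zero.2 (by rintro rfl; simp at h0)
      exact measureReal_le_mul_integral_le_of_semiPolynomial hm h hd hF hreal hne hε
  refine ⟨C, fun _ _ _ => Real.exp 3, fun n m d => ⟨?_, Real.exp_pos 3⟩, ?_, ⟨Real.exp 3, ?_⟩,
    hmain, ?_⟩
  · by_cases h0 : n * m * d = 0
    · simp only [hC, if_pos h0, zero_lt_one]
    · simp only [hC, if_neg h0]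
      have h1 : (0 : ℝ) < ((n * m * d : ℕ) : ℝ) := by exact_mod_cast Nat.pos_of_ne_zero h0
      push_cast at h1
      rw [one_div_pos]
      nlinarith
  · intro n m d hm hmn hd
    have h0 : n * m * d ≠ 0 := by
      have : 0 < n * m * d := by have := hm.trans hmn; positivity
      exact this.ne'
    simp only [hC, if_neg h0]
  · intro n m d hm hmn hd
    have hn' : (1 : ℝ) ≤ n := by exact_mod_cast hm.trans hmn
    have hm' : (1 : ℝ) ≤ m := by exact_mod_cast hm
    have hd' : (1 : ℝ) ≤ d := by exact_mod_cast hd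
    refine le_mul_of_one_le_right (Real.exp_pos 3).le ?_
    exact one_le_mul_of_one_le_of_one_le
      (one_le_mul_of_one_le_of_one_le (one_le_pow₀ hn') hm') hd'
  · rintro n d p hp ⟨U₀, hU₀⟩ ε hε
    obtain ⟨F, hF, hFU⟩ := exists_isSemiPolynomial_norm_evalUUdag_sq p hp
    have h := hmain n n (2 * d) le_rfl F hF
      (fun U => by rw [hFU, Complex.ofReal_re, Complex.ofReal_im]; exact ⟨rfl, by positivity⟩)
      ⟨U₀, by rw [hFU]; simpa using hU₀⟩ ε hε
    simpa only [hFU, Complex.ofReal_re] using h
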